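/- **Theorem.** A pair $(G,H)$ of a group and a subgroup is a *Hecke pair* if every double coset $HxH$ is a finite union of left cosets $yH$; it is *reduced* if $\bigcap_{x\in G}xHx^{-1}=\{e\}$. A *Schlichting pair* is a reduced Hecke pair $(L,K)$ with $L$ a locally compact Hausdorff topological group and $K$ a compact open subgroup. A *Schlichting completion* of $(G,H)$ is a Schlichting pair $(L,K)$ together with a homomorphism $\sigma:G\to L$ with dense image such that $\sigma^{-1}(K)=H$. Let $N=\mathbb Q^2$, $M=\mathbb Z^2$, $Q=\mathrm{GL}(2,\mathbb Q)$ and $R=\mathrm{GL}(2,\mathbb Z)$, with $Q$ acting on $N$ by matrix multiplication, and put $G=N\rtimes Q$, $H=M\rtimes R$. Let $\mathcal A_f$ be the ring of finite adeles of $\mathbb Q$ and $\mathcal Z\subset\mathcal A_f$ its subring of integral adeles. For a commutative ring $J$ let $\mathrm{SL}_\pm(2,J)$ be the group of matrices in $\mathrm{GL}(2,J)$ with determinant $1$ or $-1$. Then $(G,H)$ is a reduced Hecke pair and has a Schlichting completion. For every Schlichting completion $(L,K,\sigma)$, let $\bar R$ and $\bar Q$ denote the closures of $\sigma(R)$ and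 $\sigma(Q)$ in $L$. Then, as topological groups and compatibly with one another and with the inclusions of $R$ and $Q$, 1. $\bar R=\mathrm{SL}_\pm(2,\mathcal Z)$; 2. $\bar Q=\bigcup_{q\in Q/R}q\,\mathrm{SL}_\pm(2,\mathcal Z)=\{g\in\mathrm{GL}(2,\mathcal A_f)\mid \det g\in\mathbb Q\}$, where $\mathrm{SL}_\pm(2,\mathcal Z)$ has its usual topology (as a subgroup of $\mathrm{GL}(2,\mathcal Z)$), and the group in 2 has the topology from $\mathrm{SL}_\pm(2,\mathcal Z)$: a subset $U$ is open if and only if $\{k\in\mathrm{SL}_\pm(2,\mathcal Z)\mid gk\in U\}$ is open in $\mathrm{SL}_\pm(2,\mathcal Z)$ for every $g$ in the group. This topology is not the topology of entrywise convergence in $\mathcal A_f$, i.e. not the one induced by the inclusion into $\mathrm M(2,\mathcal A_f)=\mathcal A_f^4$. -/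

import Mathlib

open scoped Pointwise
open Matrix IsDedekindDomain

universe u

noncomputable section

section HeckePairs

variable {G : Type*} [Group G]

/-- `(G, H)` is a Hecke pair: every double coset `HxH` is a finite union of left cosets `yH`. -/
def IsHeckePair (H : Subgroup G) : Prop :=
  ∀ x : G, ∃ t : Finset G, DoubleCoset.doubleCoset x (H : Set G) (H : Set G) =
    ⋃ y ∈ t, y • (H : Set G)

/-- `(G, H)` is reduced: the intersection of all conjugates `xHx⁻¹` is trivial. -/
def IsReducedPair (H : Subgroup G) : Prop :=
  (⨅ x : G, H.map (MulAut.conj x).toMonoidHom) = ⊥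

/-- `(L, K)` is a Schlichting pair: a reduced Hecke pair in which `L` is a locally compact
Hausdorff group and `K` is a compact open subgroup. -/
structure IsSchlichtingPair {L : Type*} [Group L] [TopologicalSpace L] [IsTopologicalGroup L]
    (K : Subgroup L) : Prop where
  hecke : IsHeckePair K
  reduced : IsReducedPair K
  locallyCompact : LocallyCompactSpace L
  t2 : T2Space L
  isCompact : IsCompact (K : Set L)
  isOpen : IsOpen (K : Set L)

/-- `(L, K)`, together with the homomorphism `σ : G → L`, is a Schlichting completion of the pair
`(G, H)`: it is a Schlichting pair, `σ(G)` is dense in `L`, and `H = σ⁻¹(K)`. -/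
structure IsSchlichtingCompletion (H : Subgroup G) {L : Type*} [Group L] [TopologicalSpace L]
    [IsTopologicalGroup L] (K : Subgroup L) (σ : G →* L) : Prop where
  schlichting : IsSchlichtingPair K
  dense : DenseRange σ
  comap_eq : K.comap σ = H

end HeckePairs

section RationalGroups

/-- The action of `GL(2, ℚ)` on `ℚ²` (written multiplicatively) by matrix multiplication on
column vectors. -/
def glAction : GL (Fin 2) ℚ →* MulAut (Multiplicative (Fin 2 → ℚ)) where
  toFun g := AddEquiv.toMultiplicative
    { toFun := fun v => (g : Matrix (Fin 2) (Fin 2) ℚ) *ᵥ v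
      invFun := fun v => ((g⁻¹ : GL (Fin 2) ℚ) : Matrix (Fin 2) (Fin 2) ℚ) *ᵥ v
      left_inv := fun v => by
        simp only [Matrix.mulVec_mulVec, ← Units.val_mul, inv_mul_cancel, Units.val_one, Matrix.one_mulVec]
      right_inv := fun v => by
        simp only [Matrix.mulVec_mulVec, ← Units.val_mul, mul_inv_cancel, Units.val_one, Matrix.one_mulVec]
      map_add' := fun v w => Matrix.mulVec_add _ v w }
  map_one' := by
    ext v : 1
    exact Matrix.one_mulVec (Multiplicative.toAdd v)
  map_mul' g h := by
    ext v : 1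
    exact (Matrix.mulVec_mulVec (Multiplicative.toAdd v) (g : Matrix (Fin 2) (Fin 2) ℚ)
      (h : Matrix (Fin 2) (Fin 2) ℚ)).symm

/-- `G = N ⋊ Q` with `N = ℚ²` and `Q = GL(2, ℚ)`. -/
abbrev AffineGL2Q : Type := Multiplicative (Fin 2 → ℚ) ⋊[glAction] GL (Fin 2) ℚ

/-- `R = GL(2, ℤ)` as a subgroup of `Q = GL(2, ℚ)`. -/
def GL2Z : Subgroup (GL (Fin 2) ℚ) :=
  (Matrix.GeneralLinearGroup.map (n := Fin 2) (Int.castRingHom ℚ)).range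

/-- `M = ℤ²` as a subgroup of `N = ℚ²`. -/
def latticeZ2 : Subgroup (Multiplicative (Fin 2 → ℚ)) :=
  AddSubgroup.toSubgroup
    { carrier := {v | ∃ w : Fin 2 → ℤ, v = fun i => (w i : ℚ)}
      zero_mem' := ⟨0, by ext; simp⟩
      add_mem' := by
        rintro _ _ ⟨v, rfl⟩ ⟨w, rfl⟩
        exact ⟨v + w, by ext; simp⟩
      neg_mem' := by
        rintro _ ⟨v, rfl⟩
        exact ⟨-v, by ext; simp⟩ }

theorem glAction_mem_latticeZ2 {r : GL (Fin 2) ℚ} (hr : r ∈ GL2Z)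
    {v : Multiplicative (Fin 2 → ℚ)} (hv : v ∈ latticeZ2) : glAction r v ∈ latticeZ2 := by
  obtain ⟨r, rfl⟩ := hr
  obtain ⟨w, hw⟩ := hv
  refine ⟨(r : Matrix (Fin 2) (Fin 2) ℤ) *ᵥ w, ?_⟩
  change (((r : Matrix (Fin 2) (Fin 2) ℤ).map (Int.castRingHom ℚ)) *ᵥ (Multiplicative.toAdd v)) = _
  change Multiplicative.toAdd v = _ at hw
  rw [hw]
  ext i
  simp [Matrix.mulVec, dotProduct]

/-- `H = M ⋊ R` as a subgroup of `G = N ⋊ Q`. -/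
def affineGL2Z : Subgroup AffineGL2Q where
  carrier := {x | x.left ∈ latticeZ2 ∧ x.right ∈ GL2Z}
  one_mem' := ⟨one_mem _, one_mem _⟩
  mul_mem' := fun ha hb =>
    ⟨mul_mem ha.1 (glAction_mem_latticeZ2 ha.2 hb.1), mul_mem ha.2 hb.2⟩
  inv_mem' := fun ha =>
    ⟨glAction_mem_latticeZ2 (inv_mem ha.2) (inv_mem ha.1), inv_mem ha.2⟩

/-- `Q`, as a subgroup of `G`. -/
def subgroupQ : Subgroup AffineGL2Q := (SemidirectProduct.inr : GL (Fin 2) ℚ →* AffineGL2Q).range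

/-- `R`, as a subgroup of `G`. -/
def subgroupR : Subgroup AffineGL2Q :=
  GL2Z.map (SemidirectProduct.inr : GL (Fin 2) ℚ →* AffineGL2Q)

end RationalGroups

section AdelicGroups

/-- The ring `𝒜_f` of finite adeles of `ℚ`. -/
abbrev Af : Type := FiniteAdeleRing ℤ ℚ

/-- The ring `𝒵` of integers in `𝒜_f`: the finite adeles that are integral at every prime. -/
def Zhat : Subring Af where
  carrier := {a | ∀ v : HeightOneSpectrum ℤ, a v ∈ v.adicCompletionIntegers ℚ}
  zero_mem' := fun _ => zero_mem _
  one_mem' := fun _ => one_mem _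
  add_mem' := fun ha hb v => add_mem (ha v) (hb v)
  mul_mem' := fun ha hb v => mul_mem (ha v) (hb v)
  neg_mem' := fun ha v => neg_mem (ha v)

/-- `SL_±(2, J)`: the subgroup of `GL(2, J)` of matrices with determinant `1` or `-1`. -/
def SLpm (J : Type*) [CommRing J] : Subgroup (GL (Fin 2) J) where
  carrier := {g | (g : Matrix (Fin 2) (Fin 2) J).det = 1 ∨
    (g : Matrix (Fin 2) (Fin 2) J).det = -1}
  one_mem' := Or.inl (by simp)
  mul_mem' := by
    rintro a b (ha | ha) (hb | hb) <;> simp [Matrix.det_mul, ha, hb]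
  inv_mem' := by
    intro a ha
    have h : ((a⁻¹ : GL (Fin 2) J) : Matrix (Fin 2) (Fin 2) J).det *
        (a : Matrix (Fin 2) (Fin 2) J).det = 1 := by
      rw [← Matrix.det_mul, ← Units.val_mul, inv_mul_cancel, Units.val_one, Matrix.det_one]
    rcases ha with ha | ha
    · left; rwa [ha, mul_one] at h
    · right
      rw [ha, mul_neg, mul_one] at h
      exact neg_eq_iff_eq_neg.mp h

/-- The inclusion `GL(2, ℚ) → GL(2, 𝒜_f)` (diagonal embedding of `ℚ` in `𝒜_f`). -/
def ratToAdelic : GL (Fin 2) ℚ →* GL (Fin 2) Af :=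
  Matrix.GeneralLinearGroup.map (algebraMap ℚ Af)

/-- The inclusion `GL(2, 𝒵) → GL(2, 𝒜_f)`. -/
def integralToAdelic : GL (Fin 2) Zhat →* GL (Fin 2) Af :=
  Matrix.GeneralLinearGroup.map Zhat.subtype

/-- The subgroup `{g ∈ GL(2, 𝒜_f) | det g ∈ ℚ}` of `GL(2, 𝒜_f)`. -/
def ratDet : Subgroup (GL (Fin 2) Af) where
  carrier := {g | ∃ q : ℚ, (g : Matrix (Fin 2) (Fin 2) Af).det = algebraMap ℚ Af q}
  one_mem' := ⟨1, by simp⟩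
  mul_mem' := by
    rintro a b ⟨p, hp⟩ ⟨q, hq⟩
    exact ⟨p * q, by rw [Units.val_mul, Matrix.det_mul, hp, hq, map_mul]⟩
  inv_mem' := by
    rintro a ⟨q, hq⟩
    refine ⟨q⁻¹, ?_⟩
    have h : ((a⁻¹ : GL (Fin 2) Af) : Matrix (Fin 2) (Fin 2) Af).det *
        (a : Matrix (Fin 2) (Fin 2) Af).det = 1 := by
      rw [← Matrix.det_mul, ← Units.val_mul, inv_mul_cancel, Units.val_one, Matrix.det_one]
    rw [hq] at h
    by_cases h0 : q = 0
    · rw [h0, map_zero, mul_zero] at h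
      rw [h0, _root_.inv_zero, map_zero, ← mul_one (Matrix.det _), ← h, mul_zero]
    · calc _ = ((a⁻¹ : GL (Fin 2) Af) : Matrix (Fin 2) (Fin 2) Af).det *
            (algebraMap ℚ Af q * algebraMap ℚ Af q⁻¹) := by
              rw [← map_mul, mul_inv_cancel₀ h0, map_one, mul_one]
        _ = _ := by rw [← mul_assoc, h, one_mul]

theorem integralToAdelic_mem_ratDet {k : GL (Fin 2) Zhat} (hk : k ∈ SLpm Zhat) :
    integralToAdelic k ∈ ratDet := by
  have h : ((integralToAdelic k : GL (Fin 2) Af) : Matrix (Fin 2) (Fin 2) Af).det =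
      Zhat.subtype (k : Matrix (Fin 2) (Fin 2) Zhat).det :=
    (RingHom.map_det Zhat.subtype (k : Matrix (Fin 2) (Fin 2) Zhat)).symm
  rcases hk with hk | hk
  · exact ⟨1, by rw [h, hk, map_one, map_one]⟩
  · exact ⟨-1, by rw [h, hk, map_neg, map_one, map_neg, map_one]⟩

theorem ratToAdelic_mem_ratDet (q : GL (Fin 2) ℚ) : ratToAdelic q ∈ ratDet :=
  ⟨(q : Matrix (Fin 2) (Fin 2) ℚ).det,
    (RingHom.map_det (algebraMap ℚ Af) (q : Matrix (Fin 2) (Fin 2) ℚ)).symm⟩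

/-- The group `{g ∈ GL(2, 𝒜_f) | det g ∈ ℚ}`, as a type of its own: it does not inherit a
topology from `GL(2, 𝒜_f)`, but gets the one from `SL_±(2, 𝒵)` below. -/
def RatDetGroup : Type := ratDet

instance : Group RatDetGroup := inferInstanceAs (Group ratDet)

/-- The underlying matrix with entries in `𝒜_f`. -/
def RatDetGroup.toMatrix (g : RatDetGroup) : Matrix (Fin 2) (Fin 2) Af :=
  ((g.1 : GL (Fin 2) Af) : Matrix (Fin 2) (Fin 2) Af)

/-- The inclusion of `SL_±(2, 𝒵)` in `{g ∈ GL(2, 𝒜_f) | det g ∈ ℚ}`. -/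
def slpmToRatDet : SLpm Zhat →* RatDetGroup :=
  (integralToAdelic.comp (SLpm Zhat).subtype).codRestrict ratDet
    fun k => integralToAdelic_mem_ratDet k.2

/-- The inclusion of `GL(2, ℚ)` in `{g ∈ GL(2, 𝒜_f) | det g ∈ ℚ}`. -/
def ratToRatDet : GL (Fin 2) ℚ →* RatDetGroup :=
  ratToAdelic.codRestrict ratDet ratToAdelic_mem_ratDet

/-- The topology from `SL_±(2, 𝒵)` on `{g ∈ GL(2, 𝒜_f) | det g ∈ ℚ}`: each coset `g SL_±(2, 𝒵)` is
open and carries the topology transported from `SL_±(2, 𝒵)` by `k ↦ gk`. That is, `U` is open iff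
`{k ∈ SL_±(2, 𝒵) | gk ∈ U}` is open for every `g`. -/
instance : TopologicalSpace RatDetGroup :=
  ⨆ g : RatDetGroup, TopologicalSpace.coinduced (fun k : SLpm Zhat => g * slpmToRatDet k)
    inferInstance

/-- The inclusion of `GL(2, ℤ)` in `SL_±(2, 𝒵)`. -/
def intToSLpm : GL (Fin 2) ℤ →* SLpm Zhat :=
  (Matrix.GeneralLinearGroup.map (n := Fin 2) (Int.castRingHom Zhat)).codRestrict (SLpm Zhat)
    fun r => by
      have h : ((Matrix.GeneralLinearGroup.map (n := Fin 2) (Int.castRingHom Zhat) r :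
          GL (Fin 2) Zhat) : Matrix (Fin 2) (Fin 2) Zhat).det =
          Int.castRingHom Zhat (r : Matrix (Fin 2) (Fin 2) ℤ).det :=
        (RingHom.map_det (Int.castRingHom Zhat) (r : Matrix (Fin 2) (Fin 2) ℤ)).symm
      have hu : IsUnit (r : Matrix (Fin 2) (Fin 2) ℤ).det :=
        (Matrix.isUnit_iff_isUnit_det _).mp r.isUnit
      rcases Int.isUnit_iff.mp hu with h1 | h1
      · left; rw [h, h1, map_one]
      · right; rw [h, h1, map_neg, map_one]

end AdelicGroups

end

/-! ### Hecke pairs and uniqueness of Schlichting completions -/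

section HeckePairTheory

open Topology

/-! Write P for the group of g in GL(2, 𝒜_f) with rational determinant. Any two Schlichting
completions of the same pair are isomorphic compatibly with the maps from G: the closure of the
diagonal image of G in L × L' is the graph of an isomorphism (`exists_continuousMulEquiv`).
Compactness of K and K' makes the graph project onto each factor, and reducedness makes it
single-valued. It therefore suffices to study one completion, 𝒜_f² ⋊ P with compact open subgroup 𝒵²
⋊ SL_±(2, 𝒵). That G and H form a reduced Hecke pair also follows from its existence.

In this model P and SL_±(2, 𝒵) are closed subgroups, so the claim about closures becomes density of
Q in P and of R in SL_±(2, 𝒵). The first is strong approximation (`denseRange_ratToRatDet`): ℚ is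
dense in 𝒜_f by the Chinese remainder theorem, 𝒜_f has stable rank one, so elementary matrices
generate SL(2, 𝒜_f), and diagonal rational matrices supply the determinants. The second follows
because SL_±(2, 𝒵) is open in P and meets Q in R.

The topology of P is handled by identifying it with the GL(2, 𝒜_f) topology refined so that the
determinant is locally constant (`topology_eq`); this makes P a topological group. It is not the
entrywise topology, because positive integers n can be arbitrarily close to 0 in 𝒜_f, while diag(1 +
n, 1) never has determinant 1 or -1. -/

theorem isHeckePair_of_isCompact_of_isOpen {L : Type*} [Group L] [TopologicalSpace L]
    [IsTopologicalGroup L] {K : Subgroup L} (hc : IsCompact (K : Set L))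
    (ho : IsOpen (K : Set L)) : IsHeckePair K := by
  intro x
  have hD : IsCompact (DoubleCoset.doubleCoset x (K : Set L) (K : Set L)) :=
    (hc.mul isCompact_singleton).mul hc
  -- Left cosets of K are open, so finitely many of them, centred inside the compact double coset,
  -- cover it.
  obtain ⟨t, ht, hcov⟩ := hD.elim_nhds_subcover (fun y => y • (K : Set L)) fun y _ =>
    (ho.smul y).mem_nhds ⟨1, one_mem K, by simp⟩
  refine ⟨t, hcov.antisymm (Set.iUnion₂_subset fun y hy => ?_)⟩
  rintro _ ⟨k, hk, rfl⟩
  obtain ⟨a, ha, b, hb, rfl⟩ := DoubleCoset.mem_doubleCoset.mp (ht y hy)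
  exact DoubleCoset.mem_doubleCoset.mpr ⟨a, ha, b * k, mul_mem hb hk, by simp [mul_assoc]⟩

theorem isReducedPair_iff {G : Type*} [Group G] {H : Subgroup G} :
    IsReducedPair H ↔ ∀ g : G, (∀ x : G, x⁻¹ * g * x ∈ H) → g = 1 := by
  have key : ∀ g : G, g ∈ (⨅ x : G, H.map (MulAut.conj x).toMonoidHom) ↔
      ∀ x : G, x⁻¹ * g * x ∈ H := by
    intro g
    rw [Subgroup.mem_iInf]
    refine forall_congr' fun x => ⟨?_, fun h => ⟨_, h, by simp [mul_assoc]⟩⟩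
    rintro ⟨h, hh, rfl⟩
    simpa [mul_assoc] using hh
  rw [IsReducedPair, Subgroup.eq_bot_iff_forall]
  simp_rw [key]

namespace IsSchlichtingCompletion

variable {G : Type*} [Group G] {H : Subgroup G}
  {L : Type*} [Group L] [TopologicalSpace L] [IsTopologicalGroup L] {K : Subgroup L} {σ : G →* L}
  {L' : Type*} [Group L'] [TopologicalSpace L'] [IsTopologicalGroup L'] {K' : Subgroup L'}
  {σ' : G →* L'}

theorem mem_iff (h : IsSchlichtingCompletion H K σ) {g : G} : σ g ∈ K ↔ g ∈ H := by
  rw [← h.comap_eq, Subgroup.mem_comap]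

theorem exists_inv_mul_mem (h : IsSchlichtingCompletion H K σ) (x : L) :
    ∃ g : G, (σ g)⁻¹ * x ∈ K := by
  have ho : IsOpen {y : L | y⁻¹ * x ∈ K} :=
    h.schlichting.isOpen.preimage (f := fun y : L => y⁻¹ * x) (by fun_prop)
  obtain ⟨g, hg⟩ := h.dense.exists_mem_open ho ⟨x, by simp⟩
  exact ⟨g, hg⟩

/-- By density each left coset of K in L has a representative in σ(G), so a finite decomposition of
Kσ(x)K pulls back to G. Representatives falling outside HxH are discarded. -/
theorem isHeckePair (h : IsSchlichtingCompletion H K σ) : IsHeckePair H := by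
  classical
  intro x
  obtain ⟨t, ht⟩ := h.schlichting.hecke (σ x)
  choose r hr using h.exists_inv_mul_mem
  refine ⟨(t.image r).filter fun y => y ∈ DoubleCoset.doubleCoset x (H : Set G) (H : Set G), ?_⟩
  ext z
  simp only [Set.mem_iUnion, Finset.mem_filter, Finset.mem_image, exists_prop]
  constructor
  · intro hz
    obtain ⟨a, ha, b, hb, rfl⟩ := DoubleCoset.mem_doubleCoset.mp hz
    have hσ : σ (a * x * b) ∈ DoubleCoset.doubleCoset (σ x) (K : Set L) (K : Set L) :=
      DoubleCoset.mem_doubleCoset.mpr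
        ⟨σ a, h.mem_iff.mpr ha, σ b, h.mem_iff.mpr hb, by simp⟩
    rw [ht] at hσ
    simp only [Set.mem_iUnion, exists_prop] at hσ
    obtain ⟨y, hy, k, hk, hyk⟩ := hσ
    have hmem : (r y)⁻¹ * (a * x * b) ∈ H := by
      rw [← h.mem_iff, map_mul, map_inv, ← hyk]
      simpa [mul_assoc] using mul_mem (hr y) hk
    refine ⟨r y, ⟨⟨y, hy, rfl⟩, DoubleCoset.mem_doubleCoset.mpr
      ⟨a, ha, b * ((r y)⁻¹ * (a * x * b))⁻¹, mul_mem hb (inv_mem hmem), by group⟩⟩, ?_⟩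
    exact ⟨_, hmem, by simp⟩
  · rintro ⟨y, ⟨-, hy⟩, k, hk, rfl⟩
    obtain ⟨a, ha, b, hb, rfl⟩ := DoubleCoset.mem_doubleCoset.mp hy
    exact DoubleCoset.mem_doubleCoset.mpr ⟨a, ha, b * k, mul_mem hb hk, by simp [mul_assoc]⟩

/-- Each x in L is σ(y)k with k in K, so conjugating K by x is the same as conjugating it by σ(y).
-/
theorem isReducedPair (h : IsSchlichtingCompletion H K σ) (hσ : Function.Injective σ) :
    IsReducedPair H := by
  rw [isReducedPair_iff]
  intro g hg
  refine hσ ?_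
  rw [map_one]
  refine isReducedPair_iff.mp h.schlichting.reduced _ fun x => ?_
  obtain ⟨y, hy⟩ := h.exists_inv_mul_mem x
  have h1 := mul_mem (mul_mem (inv_mem hy) (h.mem_iff.mpr (hg y))) hy
  simpa [mul_assoc] using h1

/-- The closure of the image of `G` in the product of two completions: it is the graph of an
isomorphism between them. -/
def graph (σ : G →* L) (σ' : G →* L') : Subgroup (L × L') :=
  (σ.prod σ').range.topologicalClosure

theorem mem_graph_self (σ : G →* L) (σ' : G →* L') (g : G) : (σ g, σ' g) ∈ graph σ σ' :=
  Subgroup.le_topologicalClosure _ ⟨g, rfl⟩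

theorem isClosed_graph : IsClosed (graph σ σ' : Set (L × L')) :=
  Subgroup.isClosed_topologicalClosure _

theorem mem_graph_swap {p : L × L'} (hp : p ∈ graph σ σ') : p.swap ∈ graph σ' σ := by
  refine map_mem_closure continuous_swap hp ?_
  rintro _ ⟨g, rfl⟩
  exact ⟨g, rfl⟩

/-- The set K × (L' \ K') is open and contains no (σ g, σ' g), since both preimages are H; hence it
misses the closure. -/
theorem mem_of_mem_graph (h : IsSchlichtingCompletion H K σ)
    (h' : IsSchlichtingCompletion H K' σ') {a : L} {b : L'} (hab : (a, b) ∈ graph σ σ')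
    (ha : a ∈ K) : b ∈ K' := by
  by_contra hb
  have hcl : IsClosed (K' : Set L') := K'.isClosed_of_isOpen h'.schlichting.isOpen
  obtain ⟨_, ⟨h1, h2⟩, g, rfl⟩ := mem_closure_iff.mp hab ((K : Set L) ×ˢ (K' : Set L')ᶜ)
    (h.schlichting.isOpen.prod hcl.isOpen_compl) ⟨ha, hb⟩
  exact h2 (h'.mem_iff.mpr (h.mem_iff.mp h1))

/-- The part of the graph in K × K' is compact, so its projection is closed; it contains the dense
subset σ(G) ∩ K of K. Other points are reached by translating by some σ(g). -/
theorem exists_mem_graph (h : IsSchlichtingCompletion H K σ)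
    (h' : IsSchlichtingCompletion H K' σ') (a : L) : ∃ b, (a, b) ∈ graph σ σ' := by
  have := h.schlichting.t2
  have hK : ∀ k ∈ K, ∃ b, (k, b) ∈ graph σ σ' := by
    have hc : IsCompact ((graph σ σ' : Set (L × L')) ∩ (K : Set L) ×ˢ (K' : Set L')) :=
      (h.schlichting.isCompact.prod h'.schlichting.isCompact).inter_left isClosed_graph
    have hcl := (hc.image continuous_fst).isClosed
    have hsub : (K : Set L) ⊆ closure ((K : Set L) ∩ Set.range σ) :=
      h.dense.open_subset_closure_inter h.schlichting.isOpen
    intro k hk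
    have hk' := closure_minimal (t := Prod.fst '' _) ?_ hcl (hsub hk)
    · obtain ⟨⟨_, b⟩, ⟨hb, -⟩, rfl⟩ := hk'
      exact ⟨b, hb⟩
    · rintro _ ⟨hg, g, rfl⟩
      exact ⟨(σ g, σ' g), ⟨mem_graph_self σ σ' g, hg, h'.mem_iff.mpr (h.mem_iff.mp hg)⟩, rfl⟩
  obtain ⟨g, hg⟩ := h.exists_inv_mul_mem a
  obtain ⟨b, hb⟩ := hK _ hg
  exact ⟨σ' g * b, by simpa using mul_mem (mem_graph_self σ σ' g) hb⟩

/-- Conjugating (1, b) by a graph point over x keeps the first coordinate 1, so every conjugate of b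
lies in K', and reducedness applies. -/
theorem eq_one_of_mem_graph (h : IsSchlichtingCompletion H K σ)
    (h' : IsSchlichtingCompletion H K' σ') {b : L'} (hb : (1, b) ∈ graph σ σ') : b = 1 := by
  refine isReducedPair_iff.mp h'.schlichting.reduced _ fun x => ?_
  obtain ⟨a, ha⟩ := h'.exists_mem_graph h x
  have hm := mul_mem (mul_mem (inv_mem (mem_graph_swap ha)) hb) (mem_graph_swap ha)
  exact h.mem_of_mem_graph h' (a := 1) (by simpa using hm) (one_mem K)

theorem eq_of_mem_graph (h : IsSchlichtingCompletion H K σ)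
    (h' : IsSchlichtingCompletion H K' σ') {a : L} {b c : L'} (hb : (a, b) ∈ graph σ σ')
    (hc : (a, c) ∈ graph σ σ') : b = c := by
  have := mul_mem (inv_mem hb) hc
  rw [← inv_mul_eq_one]
  exact h.eq_one_of_mem_graph h' (by simpa using this)

theorem exists_continuousMonoidHom (h : IsSchlichtingCompletion H K σ)
    (h' : IsSchlichtingCompletion H K' σ') :
    ∃ f : L →ₜ* L', ∀ g, f (σ g) = σ' g := by
  have := h.schlichting.t2
  choose f hf using h.exists_mem_graph h'
  let F : L →* L' := MonoidHom.mk' f fun a b =>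
    h.eq_of_mem_graph h' (hf _) (by simpa using mul_mem (hf a) (hf b))
  refine ⟨⟨F, continuous_of_continuousAt_one F ?_⟩,
    fun g => h.eq_of_mem_graph h' (hf _) (mem_graph_self σ σ' g)⟩
  rw [ContinuousAt, map_one]
  intro V hV
  obtain ⟨U, hUV, hU, h1U⟩ := mem_nhds_iff.mp hV
  -- The points of K having a partner in K' outside U form a compact set missing 1; its complement
  -- within K is the required neighbourhood.
  have hc : IsCompact (Prod.fst '' ((graph σ σ' : Set (L × L')) ∩
      (K : Set L) ×ˢ ((K' : Set L') ∩ Uᶜ))) :=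
    ((h.schlichting.isCompact.prod (h'.schlichting.isCompact.inter_right
      hU.isClosed_compl)).inter_left isClosed_graph).image continuous_fst
  have h1 : (1 : L) ∉ Prod.fst '' ((graph σ σ' : Set (L × L')) ∩
      (K : Set L) ×ˢ ((K' : Set L') ∩ Uᶜ)) := by
    rintro ⟨⟨a, b⟩, ⟨hab, -, -, hbU⟩, rfl⟩
    exact hbU (h.eq_one_of_mem_graph h' hab ▸ h1U)
  refine Filter.mem_map.mpr ?_
  filter_upwards [hc.isClosed.isOpen_compl.mem_nhds h1,
    h.schlichting.isOpen.mem_nhds (one_mem K)] with a ha haK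
  by_contra hfa
  exact ha ⟨(a, f a), ⟨hf a, haK, h.mem_of_mem_graph h' (hf a) haK, fun hu => hfa (hUV hu)⟩, rfl⟩

/-- Schlichting completions are unique up to a unique isomorphism. -/
theorem exists_continuousMulEquiv (h : IsSchlichtingCompletion H K σ)
    (h' : IsSchlichtingCompletion H K' σ') : ∃ e : L ≃ₜ* L', ∀ g, e (σ g) = σ' g := by
  have := h.schlichting.t2
  have := h'.schlichting.t2
  obtain ⟨f, hf⟩ := h.exists_continuousMonoidHom h'
  obtain ⟨f', hf'⟩ := h'.exists_continuousMonoidHom h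
  have e1 : ⇑f' ∘ ⇑f = id := h.dense.equalizer (f'.continuous_toFun.comp f.continuous_toFun)
    continuous_id (by ext g; simp [hf, hf'])
  have e2 : ⇑f ∘ ⇑f' = id := h'.dense.equalizer (f.continuous_toFun.comp f'.continuous_toFun)
    continuous_id (by ext g; simp [hf, hf'])
  exact ⟨{ toFun := f, invFun := f', left_inv := congrFun e1, right_inv := congrFun e2,
           map_mul' := map_mul f, continuous_toFun := f.continuous_toFun,
           continuous_invFun := f'.continuous_toFun }, hf⟩

end IsSchlichtingCompletion

theorem Topology.IsClosedEmbedding.exists_topologicalClosure_equiv {T L : Type*} [Group T]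
    [TopologicalSpace T] [Group L] [TopologicalSpace L] [IsTopologicalGroup L] {j : T →* L}
    (hj : IsClosedEmbedding j) {D : Set T} (hD : Dense D) {S : Subgroup L}
    (hS : j '' D = (S : Set L)) : ∃ e : S.topologicalClosure ≃ₜ* T, ∀ x, j (e x) = x := by
  have hr : ∀ x, x ∈ S.topologicalClosure ↔ x ∈ Set.range j := by
    intro x
    rw [← SetLike.mem_coe, Subgroup.topologicalClosure_coe, ← hS, hj.closure_image_eq,
      hD.closure_eq, Set.image_univ]
  choose e he using fun x : S.topologicalClosure => (hr x).mp x.2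
  have hcont : Continuous e := hj.isInducing.continuous_iff.mpr
    (by simpa [Function.comp_def, he] using continuous_subtype_val)
  exact ⟨{ toFun := e
           invFun := fun t => ⟨j t, (hr _).mpr ⟨t, rfl⟩⟩
           left_inv := fun x => Subtype.ext (he x)
           right_inv := fun t => hj.injective (he _)
           map_mul' := fun x y => hj.injective (by simp [he])
           continuous_toFun := hcont
           continuous_invFun := hj.continuous.subtype_mk _ }, he⟩

end HeckePairTheory

/-! ### Finite adeles: compactness, density of ℚ, integrality -/

section FiniteAdeles

open Topology HeightOneSpectrum

section LocalIntegers

variable {R : Type*} [CommRing R] [Algebra R ℚ] [IsIntegralClosure R ℤ ℚ] [IsDedekindDomain R]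
  [IsFractionRing R ℚ]

theorem compactSpace_adicCompletionIntegers (v : HeightOneSpectrum R) :
    CompactSpace (v.adicCompletionIntegers ℚ) := by
  have : Fact (Nat.Prime (Rat.HeightOneSpectrum.natGenerator v)) :=
    ⟨Rat.HeightOneSpectrum.prime_natGenerator v⟩
  exact (Rat.HeightOneSpectrum.adicCompletionIntegers.padicIntEquiv
    v).toHomeomorph.symm.compactSpace

/-- Transported to the p-adic integers, an open set contains a ball around an integer. Stating this
as a congruence prepares for the Chinese remainder theorem. -/
theorem exists_forall_intCast_mem (v : HeightOneSpectrum R) {V : Set (v.adicCompletionIntegers ℚ)}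
    (hV : IsOpen V) (hne : V.Nonempty) :
    ∃ (z : ℤ) (n : ℕ), ∀ y : ℤ, (Rat.HeightOneSpectrum.natGenerator v : ℤ) ^ n ∣ y - z →
      (y : v.adicCompletionIntegers ℚ) ∈ V := by
  have : Fact (Nat.Prime (Rat.HeightOneSpectrum.natGenerator v)) :=
    ⟨Rat.HeightOneSpectrum.prime_natGenerator v⟩
  have : Fact (Nat.Prime (Rat.HeightOneSpectrum.primesEquiv v : ℕ)) :=
    ⟨Rat.HeightOneSpectrum.prime_natGenerator v⟩
  let e := Rat.HeightOneSpectrum.adicCompletionIntegers.padicIntEquiv v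
  have hU : IsOpen (e.symm ⁻¹' V) := hV.preimage e.symm.continuous
  obtain ⟨z, hz⟩ := (PadicInt.denseRange_intCast
    (p := Rat.HeightOneSpectrum.primesEquiv v)).exists_mem_open hU
      (hne.preimage e.symm.surjective)
  obtain ⟨ε, hε, hball⟩ := Metric.isOpen_iff.mp hU _ hz
  obtain ⟨n, hn⟩ := PadicInt.exists_pow_neg_lt (Rat.HeightOneSpectrum.primesEquiv v) hε
  refine ⟨z, n, fun y hy => ?_⟩
  have hmem : (y : ℤ_[Rat.HeightOneSpectrum.primesEquiv v]) ∈ Metric.ball (z : ℤ_[_]) ε := by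
    rw [Metric.mem_ball, dist_eq_norm, ← Int.cast_sub]
    exact ((PadicInt.norm_int_le_pow_iff_dvd).mpr hy).trans_lt hn
  simpa using hball hmem

end LocalIntegers

theorem isOpen_adicCompletionIntegers (v : HeightOneSpectrum ℤ) :
    IsOpen (v.adicCompletionIntegers ℚ : Set (v.adicCompletion ℚ)) :=
  Valued.isOpen_valuationSubring _

/-- The inclusion of the product of the local integer rings in the finite adeles. -/
def localIntegersToAf (x : ∀ v : HeightOneSpectrum ℤ, v.adicCompletionIntegers ℚ) : Af :=
  RestrictedProduct.structureMap (fun v : HeightOneSpectrum ℤ => v.adicCompletion ℚ)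
    (fun v => (v.adicCompletionIntegers ℚ : Set (v.adicCompletion ℚ))) Filter.cofinite x

theorem continuous_localIntegersToAf : Continuous localIntegersToAf :=
  (RestrictedProduct.isOpenEmbedding_structureMap isOpen_adicCompletionIntegers).continuous

theorem range_localIntegersToAf : Set.range localIntegersToAf = (Zhat : Set Af) :=
  RestrictedProduct.range_structureMap _ _

instance : T2Space Af :=
  inferInstanceAs (T2Space (RestrictedProduct (fun v : HeightOneSpectrum ℤ => v.adicCompletion ℚ)
    (fun v => (v.adicCompletionIntegers ℚ : Set (v.adicCompletion ℚ))) Filter.cofinite))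

theorem isOpen_Zhat : IsOpen (Zhat : Set Af) :=
  RestrictedProduct.isOpen_forall_mem isOpen_adicCompletionIntegers

theorem isCompact_Zhat : IsCompact (Zhat : Set Af) := by
  have h := compactSpace_adicCompletionIntegers (R := ℤ)
  rw [← range_localIntegersToAf]
  exact isCompact_range continuous_localIntegersToAf

instance : CompactSpace Zhat := isCompact_iff_compactSpace.mp isCompact_Zhat

theorem denseRange_intCast_localIntegers :
    DenseRange (fun (z : ℤ) (v : HeightOneSpectrum ℤ) => (z : v.adicCompletionIntegers ℚ)) := by
  intro x
  rw [mem_closure_iff]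
  intro U hU hx
  obtain ⟨s, V, hV, hVU⟩ := isOpen_pi_iff.mp hU x hx
  choose! z n hzn using fun v (hv : v ∈ s) =>
    exists_forall_intCast_mem v (hV v hv).1 ⟨_, (hV v hv).2⟩
  -- A basic open set constrains only the finitely many places in `s`, so one integer can meet all
  -- the congruences.
  obtain ⟨y, hy⟩ := IsDedekindDomain.exists_forall_sub_mem_ideal (s := s)
    (fun v => Ideal.span {(Rat.HeightOneSpectrum.natGenerator v : ℤ)}) n
    (fun v _ => by
      rw [Ideal.prime_span_singleton_iff, ← Nat.prime_iff_prime_int]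
      exact Rat.HeightOneSpectrum.prime_natGenerator v)
    (fun v _ w _ hvw h => hvw (Rat.HeightOneSpectrum.primesEquiv.injective (Subtype.ext (by
      rw [Ideal.span_singleton_eq_span_singleton, Int.associated_iff_natAbs] at h
      simpa only [Int.natAbs_natCast] using! h))))
    (fun v => z v)
  refine ⟨_, hVU fun v hv => hzn v hv y ?_, y, rfl⟩
  simpa [Ideal.span_singleton_pow, Ideal.mem_span_singleton] using hy v hv

theorem Zhat_subset_closure : (Zhat : Set Af) ⊆ closure (Set.range (Int.cast : ℤ → Af)) := by
  rw [← range_localIntegersToAf]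
  rintro _ ⟨x, rfl⟩
  refine map_mem_closure continuous_localIntegersToAf (denseRange_intCast_localIntegers x) ?_
  rintro _ ⟨z, rfl⟩
  exact ⟨z, rfl⟩

theorem exists_mul_intCast_mem_Zhat (a : Af) : ∃ n : ℤ, n ≠ 0 ∧ a * n ∈ Zhat := by
  classical
  choose b hb0 hb using fun v : HeightOneSpectrum ℤ =>
    adicCompletion.mul_nonZeroDivisor_mem_adicCompletionIntegers (K := ℚ) v (a v)
  have hfin : {v : HeightOneSpectrum ℤ | a v ∉ v.adicCompletionIntegers ℚ}.Finite := a.2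
  refine ⟨∏ v ∈ hfin.toFinset, b v,
    Finset.prod_ne_zero_iff.mpr fun v _ => nonZeroDivisors.ne_zero (hb0 v), fun v => ?_⟩
  change a v * ((∏ w ∈ hfin.toFinset, b w : ℤ) : v.adicCompletion ℚ) ∈ _
  by_cases hv : a v ∈ v.adicCompletionIntegers ℚ
  · exact mul_mem hv (intCast_mem _ _)
  · rw [← Finset.mul_prod_erase _ b (hfin.mem_toFinset.mpr hv), Int.cast_mul, ← mul_assoc]
    refine mul_mem ?_ (intCast_mem _ _)
    have h := hb v
    rwa [Algebra.cast, eq_intCast] at h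

theorem denseRange_algebraMap_Af : DenseRange (algebraMap ℚ Af) := by
  intro a
  obtain ⟨n, hn, ha⟩ := exists_mul_intCast_mem_Zhat a
  have hc : a * n ∈ closure (Set.range (Int.cast : ℤ → Af)) := Zhat_subset_closure ha
  have hm : Set.MapsTo (fun x : Af => x * algebraMap ℚ Af (n : ℚ)⁻¹)
      (Set.range (Int.cast : ℤ → Af)) (Set.range (algebraMap ℚ Af)) := by
    rintro _ ⟨z, rfl⟩
    exact ⟨z * (n : ℚ)⁻¹, by rw [map_mul, map_intCast]⟩
  have h := map_mem_closure (continuous_mul_const (algebraMap ℚ Af (n : ℚ)⁻¹)) hc hm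
  have hn' : (n : Af) * algebraMap ℚ Af (n : ℚ)⁻¹ = 1 := by
    rw [← map_intCast (algebraMap ℚ Af), ← map_mul, mul_inv_cancel₀ (Int.cast_ne_zero.mpr hn), map_one]
  rwa [mul_assoc, hn', mul_one] at h

theorem algebraMap_mem_Zhat_iff {q : ℚ} : algebraMap ℚ Af q ∈ Zhat ↔ ∃ z : ℤ, (z : ℚ) = q := by
  have h : algebraMap ℚ Af q ∈ Zhat ↔ ∀ v : HeightOneSpectrum ℤ, v.valuation ℚ q ≤ 1 :=
    forall_congr' fun v => by
      rw [FiniteAdeleRing.algebraMap_apply, mem_adicCompletionIntegers,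
        valuedAdicCompletion_eq_valuation']
  rw [h]
  constructor
  · intro h
    obtain ⟨z, hz⟩ := mem_integers_of_valuation_le_one ℚ q h
    exact ⟨z, hz⟩
  · rintro ⟨z, rfl⟩ v
    exact v.valuation_le_one z

instance : Nontrivial Af := by
  let v : HeightOneSpectrum ℤ := Rat.HeightOneSpectrum.primesEquiv.symm ⟨2, Nat.prime_two⟩
  exact ⟨0, 1, fun h => zero_ne_one (α := v.adicCompletion ℚ) (DFunLike.congr_fun h v)⟩

theorem algebraMap_Af_injective : Function.Injective (algebraMap ℚ Af) :=
  (algebraMap ℚ Af).injective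

theorem isClosed_Zhat : IsClosed (Zhat : Set Af) := isCompact_Zhat.isClosed

/-- Since `Zhat` is closed and ℚ is dense, b𝒜_f lies in `Zhat`. If b were nonzero at v, the adele
b_v⁻¹π⁻¹ supported at v would make π⁻¹ integral. -/
theorem eq_zero_of_forall_mul_mem_Zhat {b : Af}
    (h : ∀ q : ℚ, b * algebraMap ℚ Af q ∈ Zhat) : b = 0 := by
  classical
  have hall : ∀ a : Af, b * a ∈ Zhat := fun a =>
    (isClosed_Zhat.preimage (f := fun a : Af => b * a) (by fun_prop)).closure_subset_iff.mpr
      (by rintro _ ⟨q, rfl⟩; exact h q) (denseRange_algebraMap_Af a)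
  refine DFunLike.ext _ _ fun v => ?_
  by_contra hb
  change b v ≠ 0 at hb
  obtain ⟨π, hπ⟩ := v.valuation_exists_uniformizer ℚ
  have h1 := hall (RestrictedProduct.single (fun v : HeightOneSpectrum ℤ =>
    v.adicCompletionIntegers ℚ) v ((b v)⁻¹ * algebraMap ℚ Af π⁻¹ v)) v
  change b v * Pi.single v _ v ∈ _ at h1
  rw [Pi.single_eq_same, mul_inv_cancel_left₀ hb, FiniteAdeleRing.algebraMap_apply, mem_adicCompletionIntegers,
    valuedAdicCompletion_eq_valuation', map_inv₀, hπ] at h1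
  revert h1
  decide

end FiniteAdeles

/-! ### The topology of the group with rational determinant -/

section RatDetTopology

open Topology

/-- A group topology is determined by any open subgroup through its translates. This recognises the
coset-wise topology as a group topology found by other means. -/
theorem iSup_coinduced_mul_eq {P S : Type*} [Group P] [Group S] [t : TopologicalSpace P]
    [IsTopologicalGroup P] [TopologicalSpace S] {ι : S →* P} (hι : IsOpenEmbedding ι) :
    (⨆ g : P, TopologicalSpace.coinduced (fun k : S => g * ι k) inferInstance) = t := by
  refine le_antisymm (iSup_le fun g => ?_) fun U hU => ?_
  · exact (hι.continuous.const_mul g).coinduced_le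
  · rw [isOpen_iSup_iff] at hU
    refine isOpen_iff_mem_nhds.mpr fun g hg => ?_
    have hg' := isOpen_coinduced.mp (hU g)
    have ho : IsOpen ((fun k : S => g * ι k) '' ((fun k : S => g * ι k) ⁻¹' U)) :=
      ((isOpenMap_mul_left g).comp hι.isOpenMap) _ hg'
    exact Filter.mem_of_superset (ho.mem_nhds ⟨1, by simpa using hg, by simp⟩)
      (Set.image_preimage_subset _ _)

theorem Continuous.isLocallyConstant_of_finite_range {X Y : Type*} [TopologicalSpace X]
    [TopologicalSpace Y] [T1Space Y] {f : X → Y} (hf : Continuous f)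
    (hfin : (Set.range f).Finite) : IsLocallyConstant f := by
  have := hfin.to_subtype
  exact ((IsLocallyConstant.iff_continuous (Set.rangeFactorization f)).mpr
    (by fun_prop)).comp Subtype.val

namespace RatDetGroup

/-- The inclusion of `{g ∈ GL(2, 𝒜_f) | det g ∈ ℚ}` in `GL(2, 𝒜_f)`. -/
noncomputable def toGL : RatDetGroup →* GL (Fin 2) Af := ratDet.subtype

theorem toGL_injective : Function.Injective toGL := Subtype.val_injective

theorem slpmToRatDet_injective : Function.Injective slpmToRatDet := by
  intro k l h
  have h' := congrArg toGL h
  refine Subtype.ext (Units.ext (Matrix.ext fun i j => Subtype.ext ?_))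
  exact congrArg (fun g : GL (Fin 2) Af => (g : Matrix (Fin 2) (Fin 2) Af) i j) h'

theorem mem_range_slpmToRatDet {g : RatDetGroup} : g ∈ slpmToRatDet.range ↔
    (∀ i j, g.toMatrix i j ∈ Zhat) ∧ (g.toMatrix.det = 1 ∨ g.toMatrix.det = -1) := by
  constructor
  · rintro ⟨k, rfl⟩
    refine ⟨fun i j => (((k : GL (Fin 2) Zhat) : Matrix (Fin 2) (Fin 2) Zhat) i j).2, ?_⟩
    have h : (slpmToRatDet k).toMatrix.det =
        Zhat.subtype ((k : GL (Fin 2) Zhat) : Matrix (Fin 2) (Fin 2) Zhat).det :=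
      (RingHom.map_det Zhat.subtype _).symm
    rcases k.2 with hk | hk
    · left; rw [h, hk, map_one]
    · right; rw [h, hk, map_neg, map_one]
  · rintro ⟨hint, hdet⟩
    let A : Matrix (Fin 2) (Fin 2) Zhat := Matrix.of fun i j => ⟨g.toMatrix i j, hint i j⟩
    have hA : Zhat.subtype A.det = g.toMatrix.det := RingHom.map_det Zhat.subtype A
    have hA' : A.det = 1 ∨ A.det = -1 := by
      rw [← hA] at hdet
      exact hdet.imp (fun h => Subtype.ext h) (fun h => Subtype.ext h)
    have hu : IsUnit A.det := by rcases hA' with h | h <;> simp [h]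
    exact ⟨⟨Matrix.GeneralLinearGroup.mk'' A hu, hA'⟩, toGL_injective (Units.ext rfl)⟩

/-- The determinant on `{g ∈ GL(2, 𝒜_f) | det g ∈ ℚ}`. -/
noncomputable def detHom : RatDetGroup →* Afˣ := Matrix.GeneralLinearGroup.det.comp toGL

/-- The coarsest topology refining that of `GL(2, 𝒜_f)` for which the determinant is locally
constant. -/
noncomputable abbrev locallyConstantDetTopology : TopologicalSpace RatDetGroup :=
  .induced toGL Units.instTopologicalSpaceUnits ⊓ .induced detHom ⊥

theorem isTopologicalGroup_locallyConstantDetTopology :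
    @IsTopologicalGroup RatDetGroup locallyConstantDetTopology _ := by
  unfold locallyConstantDetTopology
  refine topologicalGroup_inf (t₁ := .induced toGL Units.instTopologicalSpaceUnits)
    (t₂ := .induced detHom ⊥)
    (topologicalGroup_induced toGL) ?_
  let b : TopologicalSpace Afˣ := ⊥
  have : DiscreteTopology Afˣ := ⟨rfl⟩
  exact topologicalGroup_induced detHom

/-- On SL_±(2, 𝒵) the determinant takes at most two values, hence is already locally constant, and
the refinement adds nothing. The image is open, being cut out by integrality of the entries and a
condition on the determinant. -/
theorem isOpenEmbedding_slpmToRatDet_locallyConstantDetTopology :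
    @IsOpenEmbedding _ _ _ locallyConstantDetTopology slpmToRatDet := by
  let t : TopologicalSpace RatDetGroup := locallyConstantDetTopology
  have hcont : @Continuous _ _ locallyConstantDetTopology _ toGL := by
    unfold locallyConstantDetTopology
    exact continuous_inf_dom_left (t₁ := .induced toGL Units.instTopologicalSpaceUnits)
      (t₂ := .induced detHom ⊥) continuous_induced_dom
  have hmat : ∀ i j, @Continuous _ _ t _ fun g : RatDetGroup => g.toMatrix i j := fun i j =>
    @Continuous.comp _ _ _ t _ _ _ _ (Units.continuous_val.matrix_elem i j) hcont
  have hdetopen : ∀ s : Set Afˣ, IsOpen[t] (detHom ⁻¹' s) := fun s => by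
    have : IsOpen[.induced detHom ⊥] (detHom ⁻¹' s) := ⟨s, trivial, rfl⟩
    exact (inf_le_right : t ≤ _) _ this
  have hind : @IsInducing _ _ _ t slpmToRatDet := by
    refine @IsInducing.mk _ _ _ t _ ?_
    have hemb : IsInducing (toGL ∘ slpmToRatDet) :=
      (IsInducing.generalLinearGroup_map IsInducing.subtypeVal).comp IsInducing.subtypeVal
    have h2 : Continuous fun k : SLpm Zhat => detHom (slpmToRatDet k) :=
      Matrix.GeneralLinearGroup.continuous_det.comp hemb.continuous
    have h3 : IsLocallyConstant fun k : SLpm Zhat => detHom (slpmToRatDet k) := by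
      refine h2.isLocallyConstant_of_finite_range
        (Set.Finite.subset (Set.toFinite {1, -1}) ?_)
      rintro _ ⟨k, rfl⟩
      rcases (mem_range_slpmToRatDet.mp ⟨k, rfl⟩).2 with h | h
      · exact Or.inl (Units.ext h)
      · exact Or.inr (Units.ext h)
    rw [induced_inf, induced_compose, induced_compose, ← hemb.eq_induced, left_eq_inf]
    rintro _ ⟨s, -, rfl⟩
    exact h3 s
  · refine @IsOpenEmbedding.mk _ _ _ t _ (@IsEmbedding.mk _ _ _ t _ hind slpmToRatDet_injective) ?_
    have h : Set.range slpmToRatDet = (⋂ i, ⋂ j, (fun g : RatDetGroup => g.toMatrix i j) ⁻¹' Zhat) ∩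
        detHom ⁻¹' {1, -1} := by
      ext g
      rw [← MonoidHom.coe_range, SetLike.mem_coe, mem_range_slpmToRatDet]
      refine and_congr (by simp only [Set.mem_iInter]; rfl) (or_congr ?_ ?_)
      · exact (Units.ext_iff (u := detHom g) (v := 1)).symm
      · exact (Units.ext_iff (u := detHom g) (v := -1)).symm
    rw [h]
    refine @IsOpen.inter _ t _ _ ?_ (hdetopen _)
    exact @isOpen_iInter_of_finite _ _ t _ _ fun i => @isOpen_iInter_of_finite _ _ t _ _ fun j =>
      isOpen_Zhat.preimage (hmat i j)

theorem topology_eq :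
    (inferInstance : TopologicalSpace RatDetGroup) = locallyConstantDetTopology :=
  @iSup_coinduced_mul_eq _ _ _ _ locallyConstantDetTopology
    isTopologicalGroup_locallyConstantDetTopology _ _
    isOpenEmbedding_slpmToRatDet_locallyConstantDetTopology

instance : IsTopologicalGroup RatDetGroup := by
  have h := isTopologicalGroup_locallyConstantDetTopology
  rwa [← topology_eq] at h

theorem isOpenEmbedding_slpmToRatDet : IsOpenEmbedding slpmToRatDet := by
  have h := isOpenEmbedding_slpmToRatDet_locallyConstantDetTopology
  rwa [← topology_eq] at h

theorem continuous_toGL : Continuous toGL := by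
  have h : @Continuous _ _ locallyConstantDetTopology _ toGL := by
    unfold locallyConstantDetTopology
    exact continuous_inf_dom_left (t₁ := .induced toGL Units.instTopologicalSpaceUnits)
      (t₂ := .induced detHom ⊥) continuous_induced_dom
  rwa [← topology_eq] at h

theorem continuous_toMatrix : Continuous toMatrix :=
  Units.continuous_val.comp continuous_toGL

instance : T2Space RatDetGroup := .of_injective_continuous toGL_injective continuous_toGL

theorem continuous_of_continuous_toGL {X : Type*} [TopologicalSpace X] {f : X → RatDetGroup}
    (hf : Continuous fun x => toGL (f x)) {u : Afˣ} (hu : ∀ x, detHom (f x) = u) :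
    Continuous f := by
  have h : @Continuous _ _ _ locallyConstantDetTopology f := by
    refine continuous_inf_rng.mpr ⟨continuous_induced_rng.mpr hf, continuous_induced_rng.mpr ?_⟩
    have : ⇑detHom ∘ f = fun _ => u := funext hu
    rw [this]
    exact @continuous_const _ _ _ ⊥ u
  rwa [← topology_eq] at h

end RatDetGroup

end RatDetTopology

/-! ### Elementary matrices and strong approximation -/

section StrongApproximation

open Topology HeightOneSpectrum

namespace Matrix.SpecialLinearGroup

variable {A : Type*} [CommRing A]

/-- The elementary matrix `!![1, a; 0, 1]`. -/
def upperElementary (a : A) : SpecialLinearGroup (Fin 2) A :=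
  ⟨!![1, a; 0, 1], by simp [Matrix.det_fin_two]⟩

/-- The elementary matrix `!![1, 0; a, 1]`. -/
def lowerElementary (a : A) : SpecialLinearGroup (Fin 2) A :=
  ⟨!![1, 0; a, 1], by simp [Matrix.det_fin_two]⟩

theorem mem_of_isUnit_add_mul {S : Subgroup (SpecialLinearGroup (Fin 2) A)}
    (hu : ∀ a, upperElementary a ∈ S) (hl : ∀ a, lowerElementary a ∈ S)
    {g : SpecialLinearGroup (Fin 2) A} {t : A} (ht : IsUnit (g 0 0 + t * g 1 0)) : g ∈ S := by
  obtain ⟨u, hu'⟩ := ht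
  obtain ⟨a, b, c, d, hg⟩ : ∃ a b c d, (g : Matrix (Fin 2) (Fin 2) A) = !![a, b; c, d] :=
    ⟨_, _, _, _, Matrix.eta_fin_two _⟩
  have hdet : a * d - b * c = 1 := by
    rw [← Matrix.det_fin_two_of, ← hg]
    exact g.2
  have hu'' : (u : A) = a + t * c := by simpa [hg] using hu'
  have huu : (u : A) * ((u⁻¹ : Aˣ) : A) = 1 := u.mul_inv
  generalize ((u⁻¹ : Aˣ) : A) = w at huu
  -- The row operation by `t` makes the top left entry the unit u; the next makes the lower left
  -- entry 1, and the last turns u into 1. The first column is then (1, 1), and determinant 1 fixes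
  -- what remains.
  have key : upperElementary (1 - (u : A)) * lowerElementary ((1 - c) * w) * upperElementary t * g =
      lowerElementary 1 * upperElementary
        (b + t * d + (1 - (u : A)) * (d + (1 - c) * w * (b + t * d))) := by
    have e : c + (1 - c) * w * (a + t * c) = 1 := by
      rw [← hu'']; linear_combination (1 - c) * huu
    refine Subtype.ext ?_
    change !![1, 1 - (u : A); 0, 1] * !![1, 0; (1 - c) * w, 1] *
      !![1, t; 0, 1] * (g : Matrix (Fin 2) (Fin 2) A) = !![1, 0; 1, 1] * !![1, _; 0, 1]
    rw [hg]
    simp only [Matrix.mul_fin_two]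
    ext i j
    fin_cases i <;> fin_cases j
    · simp; linear_combination (1 - (u : A)) * e - hu''
    · simp; ring
    · simp; linear_combination e
    · simp; linear_combination (1 - c) * (b + t * d) * huu + d * hu'' + hdet
  have h := mul_mem (inv_mem (mul_mem (mul_mem (hu (1 - (u : A)))
    (hl ((1 - c) * w))) (hu t))) (mul_mem (hl 1) (hu (b + t * d +
      (1 - (u : A)) * (d + (1 - c) * w * (b + t * d)))))
  rwa [← key, inv_mul_cancel_left] at h

theorem continuous_upperElementary [TopologicalSpace A] [IsTopologicalRing A] :
    Continuous (upperElementary : A → SpecialLinearGroup (Fin 2) A) := by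
  refine continuous_induced_rng.mpr (continuous_matrix fun i j => ?_)
  fin_cases i <;> fin_cases j <;> simp <;> fun_prop

theorem continuous_lowerElementary [TopologicalSpace A] [IsTopologicalRing A] :
    Continuous (lowerElementary : A → SpecialLinearGroup (Fin 2) A) := by
  refine continuous_induced_rng.mpr (continuous_matrix fun i j => ?_)
  fin_cases i <;> fin_cases j <;> simp <;> fun_prop

end Matrix.SpecialLinearGroup

/-- The ring of finite adeles has stable rank one. -/
theorem exists_isUnit_add_mul_Af {a b c d : Af} (h : a * d - b * c = 1) :
    ∃ t : Af, IsUnit (a + t * c) := by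
  classical
  -- Choosing 0 or 1 at each place gives a + tc the larger of the absolute values of a and c. By ad
  -- - bc = 1 this is never zero, and equals 1 wherever a, b, c, d are all integral.
  let t : Af := localIntegersToAf fun v => if Valued.v (c v) ≤ Valued.v (a v) then 0 else 1
  have ht : ∀ v, (a + t * c) v = if Valued.v (c v) ≤ Valued.v (a v) then a v else a v + c v := by
    intro v
    change a v + ((if Valued.v (c v) ≤ Valued.v (a v) then 0 else 1 :
      v.adicCompletionIntegers ℚ) : v.adicCompletion ℚ) * c v = _
    split_ifs <;> simp
  have hv : ∀ v, Valued.v ((a + t * c) v) = max (Valued.v (a v)) (Valued.v (c v)) := by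
    intro v
    rw [ht]
    split_ifs with hca
    · exact (max_eq_left hca).symm
    · rw [Valuation.map_add_eq_of_lt_right _ (not_le.mp hca), max_eq_right (not_le.mp hca).le]
  have hdet : ∀ v, a v * d v - b v * c v = 1 := fun v => DFunLike.congr_fun h v
  refine ⟨t, FiniteAdeleRing.isUnit_iff.mpr ⟨fun v h0 => ?_, ?_⟩⟩
  · have h1 := hv v
    rw [h0, map_zero] at h1
    have ha : a v = 0 := (map_eq_zero _).mp (le_antisymm (h1 ▸ le_max_left _ _) zero_le)
    have hc : c v = 0 := (map_eq_zero _).mp (le_antisymm (h1 ▸ le_max_right _ _) zero_le)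
    have := hdet v
    simp [ha, hc] at this
  · have hint : ∀ x : Af, ∀ᶠ v in Filter.cofinite, Valued.v (x v) ≤ 1 := fun x => x.2
    filter_upwards [hint a, hint b, hint c, hint d] with v ha hb hc hd
    rw [hv]
    refine le_antisymm (max_le ha hc) ?_
    have h1 : Valued.v (a v * d v - b v * c v) = 1 := by rw [hdet, map_one]
    rw [← h1]
    refine (Valuation.map_sub _ _ _).trans (max_le_max ?_ ?_)
    · rw [map_mul]; exact mul_le_of_le_one_right' hd
    · rw [map_mul]; exact mul_le_of_le_one_left' hb

namespace RatDetGroup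

/-- The inclusion of `SL(2, 𝒜_f)` in `{g ∈ GL(2, 𝒜_f) | det g ∈ ℚ}`. -/
noncomputable def ofSL : SpecialLinearGroup (Fin 2) Af →* RatDetGroup :=
  (Matrix.SpecialLinearGroup.toGL : SpecialLinearGroup (Fin 2) Af →* _).codRestrict ratDet
    fun g => ⟨1, by rw [map_one]; exact g.2⟩

theorem continuous_ofSL : Continuous ofSL :=
  continuous_of_continuous_toGL (u := 1) Matrix.SpecialLinearGroup.continuous_toGL
    fun g => Units.ext g.2

/-- The closure of Q contains all adelic elementary matrices because ℚ is dense in 𝒜_f, hence all of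
SL(2, 𝒜_f). -/
theorem denseRange_ratToRatDet : DenseRange ratToRatDet := by
  let C : Subgroup RatDetGroup := ratToRatDet.range.topologicalClosure
  have hsub : ∀ q, ratToRatDet q ∈ C := fun q => Subgroup.le_topologicalClosure _ ⟨q, rfl⟩
  have hcl : IsClosed (C : Set RatDetGroup) := Subgroup.isClosed_topologicalClosure _
  have hext : ∀ {f : Af → SpecialLinearGroup (Fin 2) Af}, Continuous f →
      (∀ q : ℚ, ofSL (f (algebraMap ℚ Af q)) ∈ C) → ∀ a, f a ∈ C.comap ofSL := by
    intro f hf hq a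
    exact (hcl.preimage (continuous_ofSL.comp hf)).closure_subset_iff.mpr
      (by rintro _ ⟨q, rfl⟩; exact hq q) (denseRange_algebraMap_Af a)
  have hSL : ∀ g, ofSL g ∈ C := by
    intro g
    obtain ⟨t, ht⟩ := exists_isUnit_add_mul_Af
      (show g 0 0 * g 1 1 - g 0 1 * g 1 0 = 1 by rw [← Matrix.det_fin_two]; exact g.2)
    refine SpecialLinearGroup.mem_of_isUnit_add_mul (S := C.comap ofSL)
      (hext SpecialLinearGroup.continuous_upperElementary fun q => ?_)
      (hext SpecialLinearGroup.continuous_lowerElementary fun q => ?_) ht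
    · convert hsub (SpecialLinearGroup.toGL (SpecialLinearGroup.upperElementary q)) using 1
      refine toGL_injective (Units.ext (Matrix.ext fun i j => ?_))
      change (SpecialLinearGroup.upperElementary (algebraMap ℚ Af q)) i j =
        algebraMap ℚ Af (SpecialLinearGroup.upperElementary q i j)
      fin_cases i <;> fin_cases j <;> simp [SpecialLinearGroup.upperElementary]
    · convert hsub (SpecialLinearGroup.toGL (SpecialLinearGroup.lowerElementary q)) using 1
      refine toGL_injective (Units.ext (Matrix.ext fun i j => ?_))
      change (SpecialLinearGroup.lowerElementary (algebraMap ℚ Af q)) i j =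
        algebraMap ℚ Af (SpecialLinearGroup.lowerElementary q i j)
      fin_cases i <;> fin_cases j <;> simp [SpecialLinearGroup.lowerElementary]
  intro g
  change g ∈ C
  obtain ⟨q, hq⟩ := g.2
  have hq0 : q ≠ 0 := by
    rintro rfl
    have hu := (detHom g).isUnit
    rw [show ((detHom g : Afˣ) : Af) = 0 from hq.trans (map_zero _)] at hu
    exact not_isUnit_zero hu
  -- This rational matrix has the determinant of g, so dividing by it leaves an element of SL(2,
  -- 𝒜_f).
  let D : GL (Fin 2) ℚ := Matrix.GeneralLinearGroup.mkOfDetNeZero !![q, 0; 0, 1] (by simpa)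
  have hD : detHom (ratToRatDet D) = detHom g := by
    refine Units.ext (Eq.trans ?_ hq.symm)
    change (((D : Matrix (Fin 2) (Fin 2) ℚ)).map (algebraMap ℚ Af)).det = _
    rw [← RingHom.mapMatrix_apply, ← RingHom.map_det]
    simp [D]
  have h1 : detHom ((ratToRatDet D)⁻¹ * g) = 1 := by rw [map_mul, map_inv, hD, inv_mul_cancel]
  have h2 := mul_mem (hsub D) (hSL ⟨((ratToRatDet D)⁻¹ * g).toMatrix, congrArg Units.val h1⟩)
  convert h2 using 1
  rw [← inv_mul_eq_iff_eq_mul]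
  exact toGL_injective (Units.ext rfl)

end RatDetGroup

end StrongApproximation

/-! ### The integral subgroup, its cosets, and the entrywise topology -/

section IntegralPart

open Topology

theorem mem_SLpm_iff_det {J : Type*} [CommRing J] {g : GL (Fin 2) J} :
    g ∈ SLpm J ↔ Matrix.GeneralLinearGroup.det g ∈ ({1, -1} : Set Jˣ) :=
  or_congr (Units.ext_iff (u := Matrix.GeneralLinearGroup.det g) (v := 1)).symm
    (Units.ext_iff (u := Matrix.GeneralLinearGroup.det g) (v := -1)).symm

instance : CompactSpace (SLpm Zhat) := by
  have h0 : CompactSpace (Matrix (Fin 2) (Fin 2) Zhat) :=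
    inferInstanceAs (CompactSpace (Fin 2 → Fin 2 → Zhat))
  have h1 : CompactSpace (GL (Fin 2) Zhat) :=
    Units.isClosedEmbedding_embedProduct.compactSpace
  refine isCompact_iff_compactSpace.mp (IsClosed.isCompact ?_)
  have h2 : (SLpm Zhat : Set (GL (Fin 2) Zhat)) =
      Matrix.GeneralLinearGroup.det ⁻¹' ({1, -1} : Set Zhatˣ) :=
    Set.ext fun g => mem_SLpm_iff_det
  rw [h2]
  exact (Set.toFinite _).isClosed.preimage Matrix.GeneralLinearGroup.continuous_det

namespace RatDetGroup

theorem slpmToRatDet_intToSLpm (r : GL (Fin 2) ℤ) : slpmToRatDet (intToSLpm r) =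
    ratToRatDet (Matrix.GeneralLinearGroup.map (Int.castRingHom ℚ) r) := by
  refine toGL_injective (Units.ext (Matrix.ext fun i j => ?_))
  change ((((r : Matrix (Fin 2) (Fin 2) ℤ) i j : ℤ) : Zhat) : Af) =
    algebraMap ℚ Af (((r : Matrix (Fin 2) (Fin 2) ℤ) i j : ℤ) : ℚ)
  rw [map_intCast]
  rfl

theorem ratToRatDet_injective : Function.Injective ratToRatDet := by
  intro p q h
  refine Units.ext (Matrix.ext fun i j => algebraMap_Af_injective ?_)
  exact congrArg (fun g : RatDetGroup => g.toMatrix i j) h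

theorem ratToRatDet_mem_range_iff {q : GL (Fin 2) ℚ} :
    ratToRatDet q ∈ slpmToRatDet.range ↔ q ∈ GL2Z := by
  constructor
  · rw [mem_range_slpmToRatDet]
    rintro ⟨hint, hdet⟩
    choose z hz using fun i j => algebraMap_mem_Zhat_iff.mp (hint i j)
    let Z : Matrix (Fin 2) (Fin 2) ℤ := Matrix.of z
    have hZ : Z.map (Int.castRingHom ℚ) = q := Matrix.ext hz
    have h1 : (ratToRatDet q).toMatrix.det =
        algebraMap ℚ Af (q : Matrix (Fin 2) (Fin 2) ℚ).det :=
      (RingHom.map_det (algebraMap ℚ Af) _).symm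
    have h2 : (q : Matrix (Fin 2) (Fin 2) ℚ).det = (Z.det : ℚ) := by
      rw [← hZ]
      exact (RingHom.map_det (Int.castRingHom ℚ) _).symm
    have hu : IsUnit Z.det := by
      rw [h1, h2] at hdet
      rw [Int.isUnit_iff]
      refine hdet.imp (fun h => ?_) (fun h => ?_)
      · exact Int.cast_injective (α := ℚ) (algebraMap_Af_injective (by rw [h]; simp))
      · exact Int.cast_injective (α := ℚ) (algebraMap_Af_injective (by rw [h]; simp))
    exact ⟨Matrix.GeneralLinearGroup.mk'' Z hu, Units.ext hZ⟩
  · rintro ⟨r, rfl⟩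
    exact ⟨intToSLpm r, slpmToRatDet_intToSLpm r⟩

/-- An open subset of SL_±(2, 𝒵) is open in the larger group, so it meets the dense Q, and the
common points lie in R. -/
theorem denseRange_intToSLpm : DenseRange intToSLpm := by
  intro k
  refine mem_closure_iff.mpr fun U hU hk => ?_
  obtain ⟨q, l, hl, hq⟩ := denseRange_ratToRatDet.exists_mem_open
    (isOpenEmbedding_slpmToRatDet.isOpenMap U hU) ⟨_, k, hk, rfl⟩
  obtain ⟨r, rfl⟩ := ratToRatDet_mem_range_iff.mp ⟨l, hq⟩
  change _ = ratToRatDet (Matrix.GeneralLinearGroup.map (Int.castRingHom ℚ) r) at hq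
  rw [← slpmToRatDet_intToSLpm] at hq
  exact ⟨l, hl, r, (slpmToRatDet_injective hq).symm⟩

theorem isClosedEmbedding_slpmToRatDet : IsClosedEmbedding slpmToRatDet :=
  ⟨isOpenEmbedding_slpmToRatDet.isEmbedding,
    slpmToRatDet.range.isClosed_of_isOpen isOpenEmbedding_slpmToRatDet.isOpen_range⟩

theorem exists_inv_ratToRatDet_mul_mem (g : RatDetGroup) :
    ∃ q, (ratToRatDet q)⁻¹ * g ∈ slpmToRatDet.range := by
  have ho : IsOpen {h : RatDetGroup | h⁻¹ * g ∈ slpmToRatDet.range} :=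
    isOpenEmbedding_slpmToRatDet.isOpen_range.preimage (continuous_inv.mul continuous_const)
  obtain ⟨q, hq⟩ := denseRange_ratToRatDet.exists_mem_open ho ⟨g, 1, by simp⟩
  exact ⟨q, hq⟩

theorem iUnion_smul_integralToAdelic_image : (⋃ x : GL (Fin 2) ℚ ⧸ GL2Z,
      ratToAdelic x.out • (integralToAdelic '' (SLpm Zhat : Set (GL (Fin 2) Zhat)))) =
        {g : GL (Fin 2) Af | ∃ q : ℚ,
          (g : Matrix (Fin 2) (Fin 2) Af).det = algebraMap ℚ Af q} := by
  ext g
  simp only [Set.mem_iUnion]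
  constructor
  · rintro ⟨x, _, ⟨k, hk, rfl⟩, rfl⟩
    exact mul_mem (ratToAdelic_mem_ratDet x.out) (integralToAdelic_mem_ratDet hk)
  · intro hg
    let γ : RatDetGroup := ⟨g, hg⟩
    obtain ⟨q, hq⟩ := exists_inv_ratToRatDet_mul_mem γ
    -- The chosen representative of qR differs from q by an element of R, which SL_±(2, 𝒵) absorbs.
    have hout : (QuotientGroup.mk q : GL (Fin 2) ℚ ⧸ GL2Z).out⁻¹ * q ∈ GL2Z :=
      QuotientGroup.eq.mp (Quotient.out_eq _)
    have hmem := mul_mem (ratToRatDet_mem_range_iff.mpr hout) hq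
    rw [map_mul, mul_assoc, mul_inv_cancel_left] at hmem
    obtain ⟨k, hk⟩ := hmem
    refine ⟨QuotientGroup.mk q, integralToAdelic k, ⟨k, k.2, rfl⟩, ?_⟩
    have h1 := congrArg toGL hk
    change integralToAdelic k = (ratToAdelic _)⁻¹ * g at h1
    change ratToAdelic _ * integralToAdelic k = g
    rw [h1, mul_inv_cancel_left]

/-- The sequence of natural numbers has a cluster point in the compact ring 𝒵, and two distinct
terms near it have a small difference. -/
theorem exists_intCast_mem_nhds_zero {U : Set Af} (hU : U ∈ 𝓝 0) :
    ∃ n : ℕ, 0 < n ∧ (n : Af) ∈ U := by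
  obtain ⟨x, hx⟩ := exists_clusterPt_of_compactSpace
    (Filter.map (fun n : ℕ => (n : Zhat)) Filter.atTop)
  have hsub : Filter.Tendsto (fun p : Zhat × Zhat => (p.2 : Af) - p.1) (𝓝 (x, x)) (𝓝 0) := by
    have h : Continuous fun p : Zhat × Zhat => (p.2 : Af) - p.1 := by fun_prop
    simpa using h.tendsto (x, x)
  obtain ⟨V, hV, hVU⟩ := Filter.mem_prod_self_iff.mp (nhds_prod_eq (x := x) (y := x) ▸ hsub hU)
  have hfreq := mapClusterPt_iff_frequently.mp hx V hV
  obtain ⟨i, -, hi⟩ := Filter.frequently_atTop.mp hfreq 0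
  -- Starting from i + 1 makes j - i strictly positive.
  obtain ⟨j, hij, hj⟩ := Filter.frequently_atTop.mp hfreq (i + 1)
  refine ⟨j - i, by omega, ?_⟩
  have h := hVU (Set.mk_mem_prod hi hj)
  rw [Nat.cast_sub (by omega)]
  exact h

theorem topology_ne_induced_toMatrix : (inferInstance : TopologicalSpace RatDetGroup) ≠
      TopologicalSpace.induced RatDetGroup.toMatrix inferInstance := by
  intro heq
  have ho := isOpenEmbedding_slpmToRatDet.isOpen_range
  obtain ⟨V, hV, hVr⟩ : IsOpen[.induced toMatrix inferInstance] (Set.range slpmToRatDet) := by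
    rw [← heq]; exact ho
  have h1V : (1 : Matrix (Fin 2) (Fin 2) Af) ∈ V := by
    have : (1 : RatDetGroup) ∈ toMatrix ⁻¹' V := by rw [hVr]; exact ⟨1, map_one _⟩
    exact this
  let f : Af → Matrix (Fin 2) (Fin 2) Af := fun a => !![1 + a, 0; 0, 1]
  have hf : Continuous f := by
    refine continuous_matrix fun i j => ?_
    fin_cases i <;> fin_cases j <;> simp [f] <;> fun_prop
  have hf0 : f 0 = 1 := by simp [f, Matrix.one_fin_two]
  obtain ⟨n, hn, hnV⟩ := exists_intCast_mem_nhds_zero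
    (hf.continuousAt.preimage_mem_nhds (hV.mem_nhds (by rwa [hf0])))
  have hdet : Matrix.det !![1 + (n : ℚ), 0; 0, 1] = 1 + n := by simp
  let D : GL (Fin 2) ℚ := Matrix.GeneralLinearGroup.mkOfDetNeZero !![1 + (n : ℚ), 0; 0, 1]
    (by rw [hdet]; positivity)
  have hD : (ratToRatDet D).toMatrix = f n := by
    refine Matrix.ext fun i j => ?_
    change algebraMap ℚ Af (!![1 + (n : ℚ), 0; 0, 1] i j) = f n i j
    fin_cases i <;> fin_cases j <;> simp [f]
  have hmem : ratToRatDet D ∈ toMatrix ⁻¹' V := by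
    change (ratToRatDet D).toMatrix ∈ V
    rw [hD]; exact hnV
  rw [hVr] at hmem
  have h1 := (mem_range_slpmToRatDet.mp hmem).2
  have h2 : (f n).det = ((1 + n : ℤ) : Af) := by simp [f]
  rw [hD, h2] at h1
  have : CharZero Af := algebraRat.charZero Af
  rcases h1 with h1 | h1
  · have : (1 + n : ℤ) = 1 := by exact_mod_cast h1
    omega
  · have : (1 + n : ℤ) = -1 := by exact_mod_cast h1
    omega

end RatDetGroup

end IntegralPart

/-! ### The adelic model of the completion -/

section AdelicAffineGroup

open Topology

namespace RatDetGroup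

theorem toMatrix_mul (g h : RatDetGroup) : (g * h).toMatrix = g.toMatrix * h.toMatrix := rfl

theorem toMatrix_one : (1 : RatDetGroup).toMatrix = 1 := rfl

theorem toMatrix_injective : Function.Injective toMatrix := fun _ _ h =>
  toGL_injective (Units.ext h)

/-- The action of `{g ∈ GL(2, 𝒜_f) | det g ∈ ℚ}` on `𝒜_f²` (written multiplicatively) by matrix
multiplication on column vectors. -/
noncomputable def action : RatDetGroup →* MulAut (Multiplicative (Fin 2 → Af)) where
  toFun g := AddEquiv.toMultiplicative
    { toFun := fun v => g.toMatrix *ᵥ v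
      invFun := fun v => g⁻¹.toMatrix *ᵥ v
      left_inv := fun v => (Matrix.mulVec_mulVec v g⁻¹.toMatrix g.toMatrix).trans (by
        rw [← toMatrix_mul, inv_mul_cancel, toMatrix_one, Matrix.one_mulVec])
      right_inv := fun v => (Matrix.mulVec_mulVec v g.toMatrix g⁻¹.toMatrix).trans (by
        rw [← toMatrix_mul, mul_inv_cancel, toMatrix_one, Matrix.one_mulVec])
      map_add' := fun v w => Matrix.mulVec_add _ v w }
  map_one' := by
    ext v : 1
    exact Matrix.one_mulVec (Multiplicative.toAdd v)
  map_mul' g h := by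
    ext v : 1
    exact (Matrix.mulVec_mulVec (Multiplicative.toAdd v) g.toMatrix h.toMatrix).symm

theorem toAdd_action (g : RatDetGroup) (v : Multiplicative (Fin 2 → Af)) :
    (action g v).toAdd = g.toMatrix *ᵥ v.toAdd := rfl

end RatDetGroup

/-- The semidirect product of `𝒜_f²` by `{g ∈ GL(2, 𝒜_f) | det g ∈ ℚ}`. -/
abbrev AdelicAffineGroup : Type :=
  Multiplicative (Fin 2 → Af) ⋊[RatDetGroup.action] RatDetGroup

namespace AdelicAffineGroup

noncomputable instance : TopologicalSpace AdelicAffineGroup :=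
  .induced (fun x => (x.left, x.right)) inferInstance

/-- The underlying space of `𝒜_f² ⋊ {g ∈ GL(2, 𝒜_f) | det g ∈ ℚ}` is the product. -/
noncomputable def homeomorphProd :
    AdelicAffineGroup ≃ₜ Multiplicative (Fin 2 → Af) × RatDetGroup :=
  SemidirectProduct.equivProd.toHomeomorphOfIsInducing ⟨rfl⟩

theorem continuous_left : Continuous fun x : AdelicAffineGroup => x.left :=
  continuous_fst.comp homeomorphProd.continuous

theorem continuous_right : Continuous fun x : AdelicAffineGroup => x.right :=
  continuous_snd.comp homeomorphProd.continuous

theorem continuous_of_left_right {X : Type*} [TopologicalSpace X] {f : X → AdelicAffineGroup}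
    (h1 : Continuous fun x => (f x).left) (h2 : Continuous fun x => (f x).right) :
    Continuous f :=
  homeomorphProd.isInducing.continuous_iff.mpr (h1.prodMk h2)

theorem continuous_action_comp {X : Type*} [TopologicalSpace X] {f : X → RatDetGroup}
    {v : X → Multiplicative (Fin 2 → Af)} (hf : Continuous f) (hv : Continuous v) :
    Continuous fun x => RatDetGroup.action (f x) (v x) :=
  continuous_ofAdd.comp (f := fun x => (f x).toMatrix *ᵥ (v x).toAdd)
    ((RatDetGroup.continuous_toMatrix.comp hf).matrix_mulVec (continuous_toAdd.comp hv))

instance : IsTopologicalGroup AdelicAffineGroup where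
  continuous_mul := by
    refine continuous_of_left_right ?_ ?_
    · have h := continuous_action_comp (continuous_right.comp (continuous_fst (Y := AdelicAffineGroup)))
        (continuous_left.comp (continuous_snd (X := AdelicAffineGroup)))
      exact (continuous_left.comp continuous_fst).mul h
    · exact (continuous_right.comp continuous_fst).mul (continuous_right.comp continuous_snd)
  continuous_inv := by
    refine continuous_of_left_right ?_ continuous_right.inv
    exact continuous_action_comp continuous_right.inv continuous_left.inv

instance : T2Space AdelicAffineGroup := by
  have : T2Space (Multiplicative (Fin 2 → Af)) := inferInstanceAs (T2Space (Fin 2 → Af))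
  exact homeomorphProd.symm.t2Space

theorem mulVec_mem_Zhat {A : Matrix (Fin 2) (Fin 2) Af} (hA : ∀ i j, A i j ∈ Zhat) {v : Fin 2 → Af}
    (hv : ∀ i, v i ∈ Zhat) (i : Fin 2) : (A *ᵥ v) i ∈ Zhat := by
  change ∑ j, A i j * v j ∈ Zhat
  exact Subring.sum_mem _ fun j _ => mul_mem (hA i j) (hv j)

/-- The subgroup `𝒵² ⋊ SL_±(2, 𝒵)`. -/
def integral : Subgroup AdelicAffineGroup where
  carrier := {x | (∀ i, x.left.toAdd i ∈ Zhat) ∧ x.right ∈ slpmToRatDet.range}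
  one_mem' := ⟨fun _ => zero_mem _, one_mem _⟩
  mul_mem' := fun ha hb =>
    ⟨fun i => add_mem (ha.1 i)
      (mulVec_mem_Zhat (RatDetGroup.mem_range_slpmToRatDet.mp ha.2).1 hb.1 i), mul_mem ha.2 hb.2⟩
  inv_mem' := fun ha =>
    ⟨mulVec_mem_Zhat (RatDetGroup.mem_range_slpmToRatDet.mp (inv_mem ha.2)).1
      fun i => neg_mem (ha.1 i), inv_mem ha.2⟩

theorem coe_integral : (integral : Set AdelicAffineGroup) = homeomorphProd ⁻¹'
    ((Multiplicative.toAdd ⁻¹' Set.univ.pi fun _ => (Zhat : Set Af)) ×ˢ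
      Set.range slpmToRatDet) := by
  ext x
  exact and_congr_left' (by simp [homeomorphProd])

theorem isOpen_integral : IsOpen (integral : Set AdelicAffineGroup) := by
  rw [coe_integral]
  refine IsOpen.preimage homeomorphProd.continuous (IsOpen.prod ?_ ?_)
  · exact (isOpen_set_pi Set.finite_univ fun _ _ => isOpen_Zhat).preimage continuous_toAdd
  · exact RatDetGroup.isOpenEmbedding_slpmToRatDet.isOpen_range

theorem isCompact_integral : IsCompact (integral : Set AdelicAffineGroup) := by
  rw [coe_integral, homeomorphProd.isCompact_preimage]
  refine IsCompact.prod ?_ (isCompact_range RatDetGroup.isOpenEmbedding_slpmToRatDet.continuous)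
  exact isCompact_univ_pi fun _ => isCompact_Zhat

/-- Rational conjugators suffice. For x = (v, A), translations by m force (A - 1)m to be integral
for all rational m, so A = 1; scalar matrices force qv to be integral for all rational q, so v = 0.
-/
theorem isReducedPair_integral : IsReducedPair integral := by
  rw [isReducedPair_iff]
  intro x hx
  have hleft : ∀ (y : AdelicAffineGroup) i, (y⁻¹ * x * y).left.toAdd i ∈ Zhat := fun y i =>
    (hx y).1 i
  have hx1 : ∀ i, x.left.toAdd i ∈ Zhat := fun i => by simpa using hleft 1 i
  have hA : x.right = 1 := by
    refine RatDetGroup.toMatrix_injective (Matrix.ext fun i j => ?_)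
    rw [← sub_eq_zero]
    refine eq_zero_of_forall_mul_mem_Zhat fun q => ?_
    let m : Fin 2 → Af := Pi.single j (algebraMap ℚ Af q)
    have h := hleft (SemidirectProduct.inl (Multiplicative.ofAdd m)) i
    have e : ((SemidirectProduct.inl (Multiplicative.ofAdd m))⁻¹ * x *
        SemidirectProduct.inl (Multiplicative.ofAdd m) : AdelicAffineGroup).left.toAdd i =
        -m i + x.left.toAdd i + (x.right.toMatrix *ᵥ m) i := by
      rw [← map_inv]
      simp [RatDetGroup.toAdd_action]
    rw [e] at h
    have h' := sub_mem h (hx1 i)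
    have e' : -m i + x.left.toAdd i + (x.right.toMatrix *ᵥ m) i - x.left.toAdd i =
        (x.right.toMatrix i j - (1 : RatDetGroup).toMatrix i j) * algebraMap ℚ Af q := by
      have h1 : m i = (1 : RatDetGroup).toMatrix i j * algebraMap ℚ Af q := by
        simp [m, RatDetGroup.toMatrix_one, Pi.single_apply, Matrix.one_apply]
      have h2 : (x.right.toMatrix *ᵥ m) i = x.right.toMatrix i j * algebraMap ℚ Af q := by
        simp [m]
      rw [h1, h2]
      ring
    rwa [e'] at h'
  have hv : x.left = 1 := by
    refine Multiplicative.toAdd.injective (funext fun i => eq_zero_of_forall_mul_mem_Zhat fun q => ?_)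
    rcases eq_or_ne q 0 with rfl | hq
    · rw [map_zero, mul_zero]; exact zero_mem _
    let D : GL (Fin 2) ℚ := Matrix.GeneralLinearGroup.mkOfDetNeZero !![q, 0; 0, q] (by simpa)
    have h := hleft (SemidirectProduct.inr (ratToRatDet D)⁻¹) i
    have e : ((SemidirectProduct.inr (ratToRatDet D)⁻¹)⁻¹ * x *
        SemidirectProduct.inr (ratToRatDet D)⁻¹ : AdelicAffineGroup).left.toAdd i =
        ((ratToRatDet D).toMatrix *ᵥ x.left.toAdd) i := by
      rw [← map_inv, inv_inv]
      simp [RatDetGroup.toAdd_action]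
    rw [e] at h
    have hD : (ratToRatDet D).toMatrix = !![algebraMap ℚ Af q, 0; 0, algebraMap ℚ Af q] := by
      refine Matrix.ext fun i j => ?_
      change algebraMap ℚ Af (!![q, 0; 0, q] i j) = _
      fin_cases i <;> fin_cases j <;> simp
    rw [hD] at h
    convert h using 1
    fin_cases i <;> simp [Matrix.mulVec, dotProduct, mul_comm]
  exact SemidirectProduct.ext hv hA

theorem isSchlichtingPair_integral : IsSchlichtingPair integral where
  hecke := isHeckePair_of_isCompact_of_isOpen isCompact_integral isOpen_integral
  reduced := isReducedPair_integral
  locallyCompact := isCompact_integral.locallyCompactSpace_of_mem_nhds_of_group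
    (isOpen_integral.mem_nhds (one_mem integral))
  t2 := inferInstance
  isCompact := isCompact_integral
  isOpen := isOpen_integral

/-- The diagonal embedding of `ℚ² ⋊ GL(2, ℚ)`. -/
noncomputable def ofRat : AffineGL2Q →* AdelicAffineGroup :=
  SemidirectProduct.map
    (AddMonoidHom.toMultiplicative ((algebraMap ℚ Af).toAddMonoidHom.compLeft (Fin 2)))
    ratToRatDet fun g => by
      refine MonoidHom.ext fun v => Multiplicative.toAdd.injective (funext fun i => ?_)
      exact RingHom.map_mulVec (algebraMap ℚ Af) (g : Matrix (Fin 2) (Fin 2) ℚ) v.toAdd i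

theorem ofRat_inr (q : GL (Fin 2) ℚ) :
    ofRat (SemidirectProduct.inr q) = SemidirectProduct.inr (ratToRatDet q) :=
  SemidirectProduct.map_inr _ _ _ _

theorem ofRat_injective : Function.Injective ofRat := by
  intro x y h
  refine SemidirectProduct.ext (Multiplicative.toAdd.injective (funext fun i => ?_))
    (RatDetGroup.ratToRatDet_injective (congrArg SemidirectProduct.right h))
  exact algebraMap_Af_injective (congrFun (congrArg (fun z : AdelicAffineGroup => z.left.toAdd) h) i)

theorem denseRange_ofRat : DenseRange ofRat := by
  have h1 : DenseRange (Prod.map (fun v : Fin 2 → ℚ => fun i => algebraMap ℚ Af (v i))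
      ratToRatDet) :=
    DenseRange.prodMap (DenseRange.piMap fun _ => denseRange_algebraMap_Af)
      RatDetGroup.denseRange_ratToRatDet
  have h2 := (homeomorphProd.symm.surjective.denseRange.comp h1 homeomorphProd.symm.continuous)
  refine h2.mono ?_
  rintro _ ⟨⟨v, q⟩, rfl⟩
  exact ⟨⟨Multiplicative.ofAdd v, q⟩, rfl⟩

theorem isSchlichtingCompletion_ofRat :
    IsSchlichtingCompletion affineGL2Z integral ofRat where
  schlichting := isSchlichtingPair_integral
  dense := denseRange_ofRat
  comap_eq := by
    ext x
    refine and_congr ?_ RatDetGroup.ratToRatDet_mem_range_iff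
    constructor
    · intro h
      choose z hz using fun i => algebraMap_mem_Zhat_iff.mp (h i)
      exact ⟨z, funext fun i => (hz i).symm⟩
    · rintro ⟨w, hw⟩ i
      exact algebraMap_mem_Zhat_iff.mpr ⟨w i, (congrFun hw i).symm⟩

theorem isClosedEmbedding_inr : IsClosedEmbedding
    (SemidirectProduct.inr : RatDetGroup →* AdelicAffineGroup) := by
  have hcont : Continuous (SemidirectProduct.inr : RatDetGroup →* AdelicAffineGroup) :=
    continuous_of_left_right continuous_const continuous_id
  exact Function.LeftInverse.isClosedEmbedding (fun _ => rfl) continuous_right hcont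

end AdelicAffineGroup

end AdelicAffineGroup

/-! ### Transfer from the model to an arbitrary completion -/

theorem theorem5p6 :
    -- the pair `(G, H)` is a reduced Hecke pair and has a Schlichting completion
    (IsHeckePair affineGL2Z ∧ IsReducedPair affineGL2Z ∧
      ∃ (L : Type) (_ : Group L) (_ : TopologicalSpace L) (_ : IsTopologicalGroup L)
        (K : Subgroup L) (σ : AffineGL2Q →* L), IsSchlichtingCompletion affineGL2Z K σ) ∧
    -- the closures of `R` and `Q` in any Schlichting completion, as topological groups
    (∀ (L : Type u) [Group L] [TopologicalSpace L] [IsTopologicalGroup L]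
      (K : Subgroup L) (σ : AffineGL2Q →* L), IsSchlichtingCompletion affineGL2Z K σ →
      ∃ (ψ : (subgroupR.map σ).topologicalClosure ≃ₜ* SLpm Zhat)
        (φ : (subgroupQ.map σ).topologicalClosure ≃ₜ* RatDetGroup),
        (∀ (r : GL (Fin 2) ℤ) (x : (subgroupR.map σ).topologicalClosure),
          (x : L) = σ (SemidirectProduct.inr
            (Matrix.GeneralLinearGroup.map (Int.castRingHom ℚ) r)) → ψ x = intToSLpm r) ∧
        (∀ (q : GL (Fin 2) ℚ) (y : (subgroupQ.map σ).topologicalClosure),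
          (y : L) = σ (SemidirectProduct.inr q) → φ y = ratToRatDet q) ∧
        (∀ (x : (subgroupR.map σ).topologicalClosure) (y : (subgroupQ.map σ).topologicalClosure),
          (x : L) = (y : L) → φ y = slpmToRatDet (ψ x))) ∧
    -- the decomposition into cosets, indexed by `Q / R`
    (⋃ x : GL (Fin 2) ℚ ⧸ GL2Z,
      ratToAdelic x.out • (integralToAdelic '' (SLpm Zhat : Set (GL (Fin 2) Zhat)))) =
        {g : GL (Fin 2) Af | ∃ q : ℚ, (g : Matrix (Fin 2) (Fin 2) Af).det = algebraMap ℚ Af q} ∧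
    -- the topology from `SL_±(2, 𝒵)` is not the entrywise adelic topology
    (inferInstance : TopologicalSpace RatDetGroup) ≠
      TopologicalSpace.induced RatDetGroup.toMatrix inferInstance := by
  have h₀ := AdelicAffineGroup.isSchlichtingCompletion_ofRat
  refine ⟨⟨h₀.isHeckePair, h₀.isReducedPair AdelicAffineGroup.ofRat_injective, _, _, _, _, _, _, h₀⟩,
    fun L _ _ _ K σ h => ?_, RatDetGroup.iUnion_smul_integralToAdelic_image,
    RatDetGroup.topology_ne_induced_toMatrix⟩
  obtain ⟨Φ, hΦ⟩ := h₀.exists_continuousMulEquiv h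
  -- The isomorphism with the model embeds P, and through it SL_±(2, 𝒵), as closed subgroups of L.
  -- The closures of σ(Q) and σ(R) are then the images of these embeddings.
  let jQ : RatDetGroup →* L := (Φ : AdelicAffineGroup →* L).comp SemidirectProduct.inr
  have hjQ : Topology.IsClosedEmbedding jQ :=
    Φ.toHomeomorph.isClosedEmbedding.comp AdelicAffineGroup.isClosedEmbedding_inr
  have hjR : Topology.IsClosedEmbedding (jQ.comp slpmToRatDet) :=
    hjQ.comp RatDetGroup.isClosedEmbedding_slpmToRatDet
  have hq : ∀ q, jQ (ratToRatDet q) = σ (SemidirectProduct.inr q) := fun q => by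
    rw [← hΦ, AdelicAffineGroup.ofRat_inr]
    rfl
  have hr : ∀ r, jQ (slpmToRatDet (intToSLpm r)) = σ (SemidirectProduct.inr
      (Matrix.GeneralLinearGroup.map (Int.castRingHom ℚ) r)) := fun r => by
    rw [RatDetGroup.slpmToRatDet_intToSLpm, hq]
  obtain ⟨φ, hφ⟩ := hjQ.exists_topologicalClosure_equiv RatDetGroup.denseRange_ratToRatDet
    (S := subgroupQ.map σ) (by
      rw [← Set.range_comp]
      simp only [Function.comp_def, hq, subgroupQ, Subgroup.coe_map, MonoidHom.coe_range,
        ← Set.range_comp])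
  obtain ⟨ψ, hψ⟩ := hjR.exists_topologicalClosure_equiv RatDetGroup.denseRange_intToSLpm
    (S := subgroupR.map σ) (by
      rw [← Set.range_comp]
      simp only [Function.comp_def, MonoidHom.comp_apply, hr, subgroupR, GL2Z, Subgroup.coe_map,
        MonoidHom.coe_range, ← Set.range_comp])
  refine ⟨ψ, φ, fun r x hx => hjR.injective ?_, fun q y hy => hjQ.injective ?_,
    fun x y hxy => hjQ.injective ?_⟩
  · rw [hψ, hx, MonoidHom.comp_apply, hr]
  · rw [hφ, hy, hq]
  · rw [hφ, ← hxy]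
    exact (hψ x).symm
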